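/- Let $0<\zeta<1$ and $\mu>0$ be fixed. For $(X,T)\in\mathbb R^2$ and $|Z|=1$ put $$\theta(Z)=XZ+TZ^2+\frac{\mu}{\zeta}\ln\Big(\frac{Z+\zeta}{Z}\Big)$$ (principal branch of the logarithm), $\sigma_3=\mathrm{diag}(1,-1)$, and $$W(Z)=e^{-i\theta(Z)\sigma_3}\begin{pmatrix}\tfrac1{\sqrt2}&\tfrac1{\sqrt2}\\-\tfrac1{\sqrt2}&\tfrac1{\sqrt2}\end{pmatrix}e^{i\theta(Z)\sigma_3}.$$ Consider the following Riemann–Hilbert problem: find a $2\times 2$ complex matrix-valued function $R(Z)=R(Z;X,T)$, defined for $|Z|\neq1$, such that 1. $R$ is analytic for $|Z|\ne1$ and extends continuously to the unit circle both from the inside, with boundary values $R_+$, and from the outside, with boundary values $R_-$; 2. $R_+(Z)=R_-(Z)\,W(Z)$ for $|Z|=1$; 3. $R(Z)=I+\mathcal O(Z^{-1})$ as $Z\to\infty$. Then for every $(X,T)\in\mathbb R^2$ this problem has exactly one solution $R(Z;X,T)$. Moreover, for every compact set $\mathfrak K\subset\mathbb R^2$ there is a constant $C$ (depending only on $\mathfrak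 K$, $\zeta$, $\mu$) such that $|R_{ij}(Z;X,T)|\le C$ for all $(X,T)\in\mathfrak K$, all $|Z|\neq1$ and all $i,j\in\{1,2\}$. -/

import Mathlib

open Filter Topology

/-- `2 × 2` complex matrices. -/
abbrev Mat2 : Type := Matrix (Fin 2) (Fin 2) ℂ

/-- The Pauli matrix `σ₃ = diag(1, -1)`. -/
def pauli3 : Mat2 := !![1, 0; 0, -1]

/-- The matrix exponential `exp(a σ₃) = diag(exp a, exp(-a))`. -/
noncomputable def expSigma3 (a : ℂ) : Mat2 :=
  !![Complex.exp a, 0; 0, Complex.exp (-a)]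

/-- `expSigma3 a` really is the exponential of the matrix `a σ₃`. -/
theorem expSigma3_eq_exp (a : ℂ) : expSigma3 a = NormedSpace.exp (a • pauli3) := by
  have h : a • pauli3 = Matrix.diagonal ![a, -a] := by
    ext i j
    fin_cases i <;> fin_cases j <;> simp [pauli3]
  rw [h, Matrix.exp_diagonal]
  ext i j
  fin_cases i <;> fin_cases j <;> simp [expSigma3, Complex.exp_eq_exp_ℂ]

/-- The phase `X Z + T Z² + (μ/ζ) ln((Z + ζ)/Z)`, with the principal branch of the logarithm. -/
noncomputable def phase (ζ μ X T : ℝ) (Z : ℂ) : ℂ :=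
  X * Z + T * Z ^ 2 + (μ / ζ : ℝ) * Complex.log ((Z + ζ) / Z)

/-- The constant matrix `(1/√2) [[1, 1], [-1, 1]]`. -/
noncomputable def rotMat : Mat2 :=
  !![((1 / √2 : ℝ) : ℂ), ((1 / √2 : ℝ) : ℂ); -((1 / √2 : ℝ) : ℂ), ((1 / √2 : ℝ) : ℂ)]

/-- The jump matrix `e^{-iθσ₃} (1/√2) [[1, 1], [-1, 1]] e^{iθσ₃}`, where `θ` is the phase. -/
noncomputable def jumpMat (ζ μ X T : ℝ) (Z : ℂ) : Mat2 :=
  expSigma3 (-(Complex.I * phase ζ μ X T Z)) * rotMat * expSigma3 (Complex.I * phase ζ μ X T Z)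

/-- `R` solves the model Riemann–Hilbert problem on the unit circle. The circle is oriented
counterclockwise: the `+` boundary value is taken from inside, the `-` one from outside.
The values of `R` on the circle itself play no role. -/
structure IsModelRHPSolution (ζ μ X T : ℝ) (R : ℂ → Mat2) : Prop where
  /-- `R` is analytic off the unit circle. -/
  analytic : ∀ i j, AnalyticOnNhd ℂ (fun Z => R Z i j) {Z : ℂ | ‖Z‖ ≠ 1}
  /-- `R` has continuous boundary values from both sides, related by the jump condition. -/
  boundary : ∃ Rplus Rminus : ℂ → Mat2,
    ContinuousOn Rplus {Z : ℂ | ‖Z‖ = 1} ∧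
    ContinuousOn Rminus {Z : ℂ | ‖Z‖ = 1} ∧
    (∀ s : ℂ, ‖s‖ = 1 → Tendsto R (𝓝[{Z : ℂ | ‖Z‖ < 1}] s) (𝓝 (Rplus s))) ∧
    (∀ s : ℂ, ‖s‖ = 1 → Tendsto R (𝓝[{Z : ℂ | 1 < ‖Z‖}] s) (𝓝 (Rminus s))) ∧
    (∀ s : ℂ, ‖s‖ = 1 → Rplus s = Rminus s * jumpMat ζ μ X T s)
  /-- `R(Z) = I + O(Z⁻¹)` as `Z → ∞`. -/
  normalization : ∀ i j,
    (fun Z : ℂ => R Z i j - (1 : Mat2) i j) =O[Bornology.cobounded ℂ] (fun Z : ℂ => Z⁻¹)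

/-! The jump matrix `W` and its inverse `V` extend analytically to |z| > ζ, because (z + ζ)/z = 1 +
ζ/z avoids the cut there. As θ(z̄) is the conjugate of θ(z) and the middle factor is real
orthogonal, W(z) W(z̄)ᴴ = 1 on the circle.

This symmetry gives the vanishing lemma `vanishing_of_schwarz_symmetric`. If G = D V on the circle
with D → 0 at infinity, then G(z) G(z̄)ᴴ and D(z) D(z̄)ᴴ glue to an entire function tending to 0,
hence to 0. On the real axis this says G Gᴴ = 0, so G = 0 by the identity theorem, and then D = 0.
Uniqueness follows by applying this to the difference of two solutions.

For existence, take ζ < a < 1 < b and let f stand for the outer solution on |z| = b. Let C_r be the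
Cauchy transform over |t| = r. With E = C_b(f W) inside and F = M − C_a(E V) outside, the condition
f = F on |z| = b reads (1 + K) f = M. The operator K maps between disjoint circles, so it is
compact, and by the Fredholm alternative injectivity suffices. A solution of the integral equation
satisfies E = F W (`innerPart_eq_outerPart_mul`, itself an application of the vanishing lemma, with
jump `V`). A homogeneous solution therefore vanishes.

The operator 1 + K depends continuously on (X, T) in norm, and so does its inverse. Thus f is
bounded over compact sets. The unit circle lies at positive distance from both contours, so E and F
are bounded up to it. -/

/-! ### Compactness of operators with continuous kernels. -/

section KernelOperator

variable {X V F E : Type*} [TopologicalSpace X] [CompactSpace X]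
  [NormedAddCommGroup V] [NormedSpace ℂ V] [NormedAddCommGroup F] [NormedSpace ℂ F]
  [NormedAddCommGroup E] [NormedSpace ℂ E]

/-- The operator `f ↦ (x ↦ L (κ x) f)` from `F` to `C(X, E)`, where `κ` is a continuous family of
vectors on a compact space and `L` is a continuous bilinear map. -/
noncomputable def kernelOp (L : V →L[ℂ] F →L[ℂ] E) (κ : C(X, V)) : F →L[ℂ] C(X, E) :=
  LinearMap.mkContinuous
    { toFun := fun f => ⟨fun x => L (κ x) f, by fun_prop⟩
      map_add' := fun f g => by ext x; simp
      map_smul' := fun c f => by ext x; simp }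
    (‖L‖ * ‖κ‖) (fun f => by
      refine (ContinuousMap.norm_le _ (by positivity)).2 fun x => ?_
      refine (L.le_opNorm₂ (κ x) f).trans ?_
      gcongr
      exact κ.norm_coe_le_norm x)

/-- Arzelà–Ascoli: norm continuity of `κ` makes the image of the unit ball equicontinuous, with
values in a fixed compact ball. -/
theorem isCompactOperator_kernelOp [FiniteDimensional ℂ E] (L : V →L[ℂ] F →L[ℂ] E)
    (κ : C(X, V)) : IsCompactOperator (kernelOp L κ) := by
  have : ProperSpace E := FiniteDimensional.proper ℂ E
  let e := ContinuousMap.linearIsometryBoundedOfCompact X E ℂ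
  refine (isCompactOperator_iff_isCompact_closure_image_closedBall
    ((kernelOp L κ : F →L[ℂ] C(X, E)) : F →ₗ[ℂ] C(X, E)) one_pos).2 ?_
  change IsCompact (closure ((kernelOp L κ) '' Metric.closedBall 0 1))
  set A : Set C(X, E) := (kernelOp L κ) '' Metric.closedBall 0 1 with hA
  have hcomp : IsCompact (closure (e '' A)) := by
    refine BoundedContinuousFunction.arzela_ascoli (Metric.closedBall 0 (‖L‖ * ‖κ‖))
      (isCompact_closedBall _ _) _ ?_ ?_
    · rintro _ x ⟨_, ⟨f, hf, rfl⟩, rfl⟩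
      have hf1 : ‖f‖ ≤ 1 := by simpa using hf
      have h1 : e (kernelOp L κ f) x = L (κ x) f := rfl
      rw [h1, mem_closedBall_zero_iff]
      refine (L.le_opNorm₂ (κ x) f).trans ?_
      calc ‖L‖ * ‖κ x‖ * ‖f‖ ≤ ‖L‖ * ‖κ‖ * 1 := by
            gcongr
            exact κ.norm_coe_le_norm x
        _ = ‖L‖ * ‖κ‖ := mul_one _
    · intro x₀
      rw [Metric.equicontinuousAt_iff_right]
      intro ε hε
      have hc : Tendsto (fun x => ‖L‖ * ‖κ x - κ x₀‖) (𝓝 x₀) (𝓝 0) := by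
        have : Continuous fun x => ‖L‖ * ‖κ x - κ x₀‖ := by fun_prop
        simpa using this.tendsto x₀
      filter_upwards [hc.eventually_lt_const hε] with x hx
      rintro ⟨_, ⟨_, ⟨f, hf, rfl⟩, rfl⟩⟩
      have hf1 : ‖f‖ ≤ 1 := by simpa using hf
      change dist (L (κ x₀) f) (L (κ x) f) < ε
      rw [dist_comm, dist_eq_norm]
      have h2 : L (κ x) f - L (κ x₀) f = L (κ x - κ x₀) f := by simp
      rw [h2]
      refine (L.le_opNorm₂ _ f).trans_lt (lt_of_le_of_lt ?_ hx)
      exact mul_le_of_le_one_right (by positivity) hf1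
  have himg : closure (e '' A) = e '' closure A := by
    have := e.toHomeomorph.image_closure A
    simpa using this.symm
  rw [himg] at hcomp
  have := (e.toHomeomorph.isCompact_image (s := closure A)).1 (by simpa using hcomp)
  exact this

end KernelOperator

/-! ### The Cauchy transform on circles about the origin. -/

section CauchyTransform

variable {𝔸 : Type*} [NormedRing 𝔸]

/-- Extension by zero of a function on a circle. -/
noncomputable def circleExtend {r : ℝ} (f : C(Metric.sphere (0 : ℂ) r, 𝔸)) : ℂ → 𝔸 :=
  Function.extend Subtype.val f 0

theorem circleExtend_apply {r : ℝ} (f : C(Metric.sphere (0 : ℂ) r, 𝔸)) {z : ℂ}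
    (hz : z ∈ Metric.sphere (0 : ℂ) r) : circleExtend f z = f ⟨z, hz⟩ :=
  Subtype.val_injective.extend_apply f 0 ⟨z, hz⟩

theorem continuousOn_circleExtend {r : ℝ} (f : C(Metric.sphere (0 : ℂ) r, 𝔸)) :
    ContinuousOn (circleExtend f) (Metric.sphere (0 : ℂ) r) := by
  rw [continuousOn_iff_continuous_domRestrict]
  convert f.continuous using 1
  ext z
  exact circleExtend_apply f z.2

variable [NormedAlgebra ℂ 𝔸]

/-- The Cauchy transform `(2πi)⁻¹ ∮_{|t| = r} (t - z)⁻¹ g(t) dt`. -/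
noncomputable def cauchyTransform (r : ℝ) (g : ℂ → 𝔸) (z : ℂ) : 𝔸 :=
  (2 * Real.pi * Complex.I : ℂ)⁻¹ • ∮ t in C(0, r), (t - z)⁻¹ • g t

/-- The functional `f ↦ (2πi)⁻¹ ∮ f` on continuous functions on a circle. -/
noncomputable def circleFunctional (𝔸 : Type*) [NormedRing 𝔸] [NormedAlgebra ℂ 𝔸] {r : ℝ}
    (hr : 0 ≤ r) : C(Metric.sphere (0 : ℂ) r, 𝔸) →L[ℂ] 𝔸 :=
  LinearMap.mkContinuous
    { toFun := fun f => (2 * Real.pi * Complex.I : ℂ)⁻¹ • ∮ t in C(0, r), circleExtend f t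
      map_add' := fun f g => by
        rw [← smul_add, ← circleIntegral.integral_add (f := circleExtend f) (g := circleExtend g)
          ((continuousOn_circleExtend f).circleIntegrable hr)
          ((continuousOn_circleExtend g).circleIntegrable hr)]
        congr 1
        refine circleIntegral.integral_congr hr fun t ht => ?_
        simp only [circleExtend_apply _ ht, ContinuousMap.add_apply]
      map_smul' := fun c f => by
        have h : (∮ t in C(0, r), circleExtend (c • f) t) = c • ∮ t in C(0, r), circleExtend f t := by
          rw [← circleIntegral.integral_smul]
          refine circleIntegral.integral_congr hr fun t ht => ?_
          simp only [circleExtend_apply _ ht, ContinuousMap.smul_apply]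
        rw [RingHom.id_apply, h, smul_comm] }
    r (fun f => by
      refine circleIntegral.norm_two_pi_i_inv_smul_integral_le_of_norm_le_const hr
        fun z hz => ?_
      rw [circleExtend_apply f hz]
      exact f.norm_coe_le_norm _)

theorem circleFunctional_apply {r : ℝ} (hr : 0 ≤ r) (f : C(Metric.sphere (0 : ℂ) r, 𝔸)) :
    circleFunctional 𝔸 hr f
      = (2 * Real.pi * Complex.I : ℂ)⁻¹ • ∮ t in C(0, r), circleExtend f t := rfl

/-- The coordinate function `t ↦ t` on a circle, with values in a complex algebra. -/
noncomputable def circleCoord (𝔸 : Type*) [NormedRing 𝔸] [NormedAlgebra ℂ 𝔸] (r : ℝ) :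
    C(Metric.sphere (0 : ℂ) r, 𝔸) :=
  ⟨fun t => algebraMap ℂ 𝔸 t, by fun_prop⟩

/-- The Cauchy kernel is minus the resolvent of the coordinate function in the Banach algebra of
continuous functions on the circle. Continuity and holomorphy in `z`, and decay at infinity, are
then facts about resolvents. -/
theorem resolvent_circleCoord_aux {r : ℝ} {z : ℂ} (hz : ‖z‖ ≠ r) :
    ∃ u : (C(Metric.sphere (0 : ℂ) r, 𝔸))ˣ,
      (u : C(Metric.sphere (0 : ℂ) r, 𝔸))
        = algebraMap ℂ (C(Metric.sphere (0 : ℂ) r, 𝔸)) z - circleCoord 𝔸 r ∧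
      ∀ t, (↑u⁻¹ : C(Metric.sphere (0 : ℂ) r, 𝔸)) t = -algebraMap ℂ 𝔸 ((t : ℂ) - z)⁻¹ := by
  have hne : ∀ t : Metric.sphere (0 : ℂ) r, (t : ℂ) - z ≠ 0 := by
    intro t h
    have h1 : (t : ℂ) = z := sub_eq_zero.1 h
    have h2 := t.2
    rw [h1, mem_sphere_zero_iff_norm] at h2
    exact hz h2
  have hcont : Continuous fun t : Metric.sphere (0 : ℂ) r => -algebraMap ℂ 𝔸 ((t : ℂ) - z)⁻¹ := by
    have : Continuous fun t : Metric.sphere (0 : ℂ) r => ((t : ℂ) - z)⁻¹ :=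
      (continuous_subtype_val.sub continuous_const).inv₀ hne
    fun_prop
  have hx : ∀ t : Metric.sphere (0 : ℂ) r,
      (algebraMap ℂ (C(Metric.sphere (0 : ℂ) r, 𝔸)) z - circleCoord 𝔸 r) t
        = algebraMap ℂ 𝔸 (z - t) := by
    intro t
    simp [circleCoord, Algebra.algebraMap_eq_smul_one, sub_smul]
  refine ⟨⟨algebraMap ℂ _ z - circleCoord 𝔸 r, ⟨_, hcont⟩, ?_, ?_⟩, rfl, fun t => rfl⟩
  · ext t
    rw [ContinuousMap.mul_apply, hx, ContinuousMap.coe_mk, mul_neg, ← map_mul, ← map_neg]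
    have : -((z - t) * ((t : ℂ) - z)⁻¹) = 1 := by
      rw [← neg_mul, neg_sub, mul_inv_cancel₀ (hne t)]
    simp [this]
  · ext t
    rw [ContinuousMap.mul_apply, hx, ContinuousMap.coe_mk, neg_mul, ← map_mul, ← map_neg]
    have : -(((t : ℂ) - z)⁻¹ * (z - t)) = 1 := by
      rw [← mul_neg, neg_sub, inv_mul_cancel₀ (hne t)]
    simp [this]

theorem mem_resolventSet_circleCoord {r : ℝ} {z : ℂ} (hz : ‖z‖ ≠ r) :
    z ∈ resolventSet ℂ (circleCoord 𝔸 r) := by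
  obtain ⟨u, hu, -⟩ := resolvent_circleCoord_aux (𝔸 := 𝔸) hz
  exact ⟨u, hu⟩

theorem resolvent_circleCoord_apply {r : ℝ} {z : ℂ} (hz : ‖z‖ ≠ r)
    (t : Metric.sphere (0 : ℂ) r) :
    resolvent (circleCoord 𝔸 r) z t = -algebraMap ℂ 𝔸 ((t : ℂ) - z)⁻¹ := by
  obtain ⟨u, hu, hu'⟩ := resolvent_circleCoord_aux (𝔸 := 𝔸) hz
  rw [resolvent, ← hu, Ring.inverse_unit, hu']

/-- The bilinear map `(a, f) ↦ -(2πi)⁻¹ ∮ a f`. -/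
noncomputable def circlePairing (𝔸 : Type*) [NormedRing 𝔸] [NormedAlgebra ℂ 𝔸] {r : ℝ}
    (hr : 0 ≤ r) :
    C(Metric.sphere (0 : ℂ) r, 𝔸) →L[ℂ] C(Metric.sphere (0 : ℂ) r, 𝔸) →L[ℂ] 𝔸 :=
  -((ContinuousLinearMap.compL ℂ _ _ _ (circleFunctional 𝔸 hr)).comp
    (ContinuousLinearMap.mul ℂ (C(Metric.sphere (0 : ℂ) r, 𝔸))))

theorem circlePairing_resolvent {r : ℝ} (hr : 0 ≤ r) {z : ℂ} (hz : ‖z‖ ≠ r)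
    (f : C(Metric.sphere (0 : ℂ) r, 𝔸)) {g : ℂ → 𝔸}
    (hg : ∀ t : Metric.sphere (0 : ℂ) r, f t = g t) :
    circlePairing 𝔸 hr (resolvent (circleCoord 𝔸 r) z) f = cauchyTransform r g z := by
  change -(circleFunctional 𝔸 hr (resolvent (circleCoord 𝔸 r) z * f)) = _
  rw [← map_neg, circleFunctional_apply, cauchyTransform]
  congr 1
  refine circleIntegral.integral_congr hr fun t ht => ?_
  simp only [circleExtend_apply _ ht, ContinuousMap.neg_apply, ContinuousMap.mul_apply,
    resolvent_circleCoord_apply hz, hg, neg_mul, neg_neg, ← Algebra.smul_def]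

/-- The distance from `z` to the contour is at least |r − ‖z‖|. Contours of radii a and b thus give
bounds uniform up to the unit circle. -/
theorem norm_cauchyTransform_le {r δ C : ℝ} (hr : 0 ≤ r) (hδ : 0 < δ) {g : ℂ → 𝔸} {z : ℂ}
    (hz : δ ≤ |r - ‖z‖|) (hC : ∀ t ∈ Metric.sphere (0 : ℂ) r, ‖g t‖ ≤ C) :
    ‖cauchyTransform r g z‖ ≤ r * (δ⁻¹ * C) := by
  refine circleIntegral.norm_two_pi_i_inv_smul_integral_le_of_norm_le_const hr fun t ht => ?_
  have h1 : δ ≤ ‖t - z‖ := by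
    rw [mem_sphere_zero_iff_norm] at ht
    rw [← ht] at hz
    exact hz.trans (abs_norm_sub_norm_le t z)
  rw [norm_smul, norm_inv]
  have := hC t ht
  gcongr

variable [CompleteSpace 𝔸]

theorem differentiableAt_resolvent_circleCoord {r : ℝ} {z : ℂ} (hz : ‖z‖ ≠ r) :
    DifferentiableAt ℂ (resolvent (circleCoord 𝔸 r)) z := by
  have h1 := spectrum.hasDerivAt_resolvent_const_left (𝕜 := ℂ)
    (A := C(Metric.sphere (0 : ℂ) r, 𝔸)) (a := circleCoord 𝔸 r) (k := z)
  have h2 := h1 (mem_resolventSet_circleCoord (𝔸 := 𝔸) hz)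
  have h3 := h2.differentiableAt
  exact h3

theorem continuousOn_resolvent_circleCoord (r : ℝ) :
    ContinuousOn (resolvent (R := ℂ) (circleCoord 𝔸 r)) {z : ℂ | ‖z‖ ≠ r} := fun _ hz =>
  (differentiableAt_resolvent_circleCoord hz).continuousAt.continuousWithinAt

theorem differentiableAt_cauchyTransform {r : ℝ} (hr : 0 ≤ r) {g : ℂ → 𝔸}
    (hg : ContinuousOn g (Metric.sphere 0 r)) {z : ℂ} (hz : ‖z‖ ≠ r) :
    DifferentiableAt ℂ (cauchyTransform r g) z := by
  let f : C(Metric.sphere (0 : ℂ) r, 𝔸) :=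
    ⟨_, continuousOn_iff_continuous_domRestrict.1 hg⟩
  have h1 : DifferentiableAt ℂ
      (fun w => circlePairing 𝔸 hr (resolvent (circleCoord 𝔸 r) w) f) z := by
    exact (((circlePairing 𝔸 hr).flip f).differentiableAt).comp z
      (differentiableAt_resolvent_circleCoord (𝔸 := 𝔸) hz)
  refine h1.congr_of_eventuallyEq ?_
  have : ∀ᶠ w : ℂ in 𝓝 z, ‖w‖ ≠ r := (continuous_norm.tendsto z).eventually_ne hz
  filter_upwards [this] with w hw
  exact (circlePairing_resolvent hr hw f (fun t => rfl)).symm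

theorem cauchyTransform_isBigO {r : ℝ} (hr : 0 ≤ r) {g : ℂ → 𝔸}
    (hg : ContinuousOn g (Metric.sphere 0 r)) :
    cauchyTransform r g =O[Bornology.cobounded ℂ] (fun z : ℂ => z⁻¹) := by
  let f : C(Metric.sphere (0 : ℂ) r, 𝔸) :=
    ⟨_, continuousOn_iff_continuous_domRestrict.1 hg⟩
  have h1 : (fun w => (circlePairing 𝔸 hr).flip f (resolvent (circleCoord 𝔸 r) w))
      =O[Bornology.cobounded ℂ] (fun z : ℂ => z⁻¹) :=
    (((circlePairing 𝔸 hr).flip f).isBigO_comp _ _).trans (spectrum.resolvent_isBigO_inv _)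
  refine h1.congr' ?_ EventuallyEq.rfl
  filter_upwards [eventually_cobounded_le_norm (r + 1)] with w hw
  exact circlePairing_resolvent hr (by linarith : r < ‖w‖).ne' f (fun t => rfl)

/-- The Cauchy transform as an operator between continuous functions on two concentric circles. -/
noncomputable def cauchyOp (𝔸 : Type*) [NormedRing 𝔸] [NormedAlgebra ℂ 𝔸] [CompleteSpace 𝔸]
    {r s : ℝ} (hr : 0 ≤ r) (hrs : s ≠ r) :
    C(Metric.sphere (0 : ℂ) r, 𝔸) →L[ℂ] C(Metric.sphere (0 : ℂ) s, 𝔸) :=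
  kernelOp (circlePairing 𝔸 hr)
    ⟨fun z : Metric.sphere (0 : ℂ) s => resolvent (circleCoord 𝔸 r) (z : ℂ),
      (continuousOn_resolvent_circleCoord r).comp_continuous continuous_subtype_val
        fun z => by simpa [mem_sphere_zero_iff_norm.1 z.2] using hrs⟩

theorem cauchyOp_apply {r s : ℝ} (hr : 0 ≤ r) (hrs : s ≠ r)
    (f : C(Metric.sphere (0 : ℂ) r, 𝔸)) (z : Metric.sphere (0 : ℂ) s) {g : ℂ → 𝔸}
    (hg : ∀ t : Metric.sphere (0 : ℂ) r, f t = g t) :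
    cauchyOp 𝔸 hr hrs f z = cauchyTransform r g z :=
  circlePairing_resolvent hr (by simpa [mem_sphere_zero_iff_norm.1 z.2] using hrs) f hg

theorem isCompactOperator_cauchyOp [FiniteDimensional ℂ 𝔸] {r s : ℝ} (hr : 0 ≤ r)
    (hrs : s ≠ r) : IsCompactOperator (cauchyOp 𝔸 hr hrs) :=
  isCompactOperator_kernelOp _ _

/-- Cauchy's integral formula in an annulus. -/
theorem cauchyTransform_sub_cauchyTransform {r s : ℝ} (hr : 0 < r) {U : Set ℂ} (hU : IsOpen U)
    {h : ℂ → 𝔸} (hh : DifferentiableOn ℂ h U)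
    (hsub : Metric.closedBall (0 : ℂ) s \ Metric.ball 0 r ⊆ U) {z : ℂ} (hrz : r < ‖z‖)
    (hzs : ‖z‖ < s) :
    cauchyTransform s h z - cauchyTransform r h z = h z := by
  have hrs : r < s := hrz.trans hzs
  have hzU : z ∈ U := hsub ⟨by simpa using hzs.le, by simpa using hrz.le⟩
  have hsphere : ∀ ρ, r ≤ ρ → ρ ≤ s → Metric.sphere (0 : ℂ) ρ ⊆ U := by
    intro ρ h1 h2 t ht
    rw [mem_sphere_zero_iff_norm] at ht
    exact hsub ⟨by simpa [ht] using h2, by simpa [ht] using h1⟩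
  -- The slope (h t − h z)/(t − z) has a removable singularity at `z`, so both circles give the same
  -- integral. Only the outer circle winds around `z`, which leaves the term 2πi h(z).
  have key : (∮ t in C(0, s), dslope h z t) = ∮ t in C(0, r), dslope h z t := by
    refine Complex.circleIntegral_eq_of_differentiable_on_annulus_off_countable hr hrs.le
      (Set.countable_singleton z) ?_ ?_
    · exact ((continuousOn_dslope (hU.mem_nhds hzU)).2
        ⟨hh.continuousOn, hh.differentiableAt (hU.mem_nhds hzU)⟩).mono hsub
    · intro t ht
      have htU : t ∈ U := hsub ⟨Metric.ball_subset_closedBall ht.1.1,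
        fun hb => ht.1.2 (Metric.ball_subset_closedBall hb)⟩
      exact (differentiableAt_dslope_of_ne ht.2).2 (hh.differentiableAt (hU.mem_nhds htU))
  have expand : ∀ ρ, 0 < ρ → r ≤ ρ → ρ ≤ s → ‖z‖ ≠ ρ →
      (∮ t in C(0, ρ), dslope h z t)
        = (∮ t in C(0, ρ), (t - z)⁻¹ • h t) - (∮ t in C(0, ρ), (t - z)⁻¹) • h z := by
    intro ρ h0 h1 h2 h3
    have hne : ∀ t ∈ Metric.sphere (0 : ℂ) ρ, t - z ≠ 0 := by
      intro t ht hc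
      rw [sub_eq_zero] at hc
      rw [hc, mem_sphere_zero_iff_norm] at ht
      exact h3 ht
    have hinv : ContinuousOn (fun t : ℂ => (t - z)⁻¹) (Metric.sphere (0 : ℂ) ρ) :=
      (continuousOn_id.sub continuousOn_const).inv₀ hne
    have hhc : ContinuousOn h (Metric.sphere (0 : ℂ) ρ) :=
      hh.continuousOn.mono (hsphere ρ h1 h2)
    rw [← circleIntegral.integral_smul_const, ← circleIntegral.integral_sub
      (f := fun t => (t - z)⁻¹ • h t) (g := fun t => (t - z)⁻¹ • h z)
      ((hinv.smul hhc).circleIntegrable h0.le)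
      ((hinv.smul continuousOn_const).circleIntegrable h0.le)]
    refine circleIntegral.integral_congr h0.le fun t ht => ?_
    have : t ≠ z := sub_ne_zero.1 (hne t ht)
    simp only [dslope_of_ne _ this, slope_def_module, smul_sub]
  have hout : (∮ t in C(0, s), (t - z)⁻¹) = 2 * Real.pi * Complex.I :=
    circleIntegral.integral_sub_inv_of_mem_ball (by simpa using hzs)
  have hin : (∮ t in C(0, r), (t - z)⁻¹) = 0 := by
    have hne : ∀ t ∈ Metric.closedBall (0 : ℂ) r, t - z ≠ 0 := by
      intro t ht hc
      rw [sub_eq_zero] at hc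
      rw [hc, mem_closedBall_zero_iff] at ht
      linarith
    refine Complex.circleIntegral_eq_zero_of_differentiable_on_off_countable hr.le
      Set.countable_empty ((continuousOn_id.sub continuousOn_const).inv₀ hne) fun t ht => ?_
    exact (differentiableAt_id.sub_const z).inv (hne t (Metric.ball_subset_closedBall ht.1))
  rw [expand s (hr.trans hrs) hrs.le le_rfl hzs.ne, expand r hr le_rfl hrs.le hrz.ne', hout, hin,
    zero_smul, sub_zero, sub_eq_iff_eq_add, add_comm, ← sub_eq_iff_eq_add] at key
  rw [cauchyTransform, cauchyTransform, ← smul_sub, key, inv_smul_smul₀]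
  simp [Real.pi_ne_zero]

end CauchyTransform

/-! ### Liouville-type gluing and the vanishing lemma. -/

section Vanishing

/-- Liouville's theorem for a function glued along the circle. Cauchy's formula for `p` becomes an
integral of `q`, whose contour moves out to infinity; `q` is then handled by the maximum principle.
-/
theorem eq_zero_of_eqOn_circle {E : Type*} [NormedAddCommGroup E] [NormedSpace ℂ E]
    [CompleteSpace E] {p q : ℂ → E} (hp : ContinuousOn p (Metric.closedBall 0 1))
    (hp' : DifferentiableOn ℂ p (Metric.ball 0 1)) (hq : ContinuousOn q {z : ℂ | 1 ≤ ‖z‖})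
    (hq' : DifferentiableOn ℂ q {z : ℂ | 1 < ‖z‖})
    (hq0 : Tendsto q (Bornology.cobounded ℂ) (𝓝 0)) (hpq : ∀ z : ℂ, ‖z‖ = 1 → p z = q z) :
    (∀ z : ℂ, ‖z‖ ≤ 1 → p z = 0) ∧ ∀ z : ℂ, 1 ≤ ‖z‖ → q z = 0 := by
  have hfar : ∀ ε > 0, ∃ R₀ : ℝ, ∀ z : ℂ, R₀ ≤ ‖z‖ → ‖q z‖ ≤ ε := by
    intro ε hε
    have h1 : ∀ᶠ z in Bornology.cobounded ℂ, ‖q z‖ ≤ ε := by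
      have := hq0.norm
      rw [norm_zero] at this
      exact this.eventually_le_const hε
    obtain ⟨R₀, -, hR₀⟩ := hasBasis_cobounded_norm.eventually_iff.1 h1
    exact ⟨R₀, fun z hz => hR₀ hz⟩
  have hopen : IsOpen {z : ℂ | 1 < ‖z‖} := isOpen_lt continuous_const continuous_norm
  have hin : ∀ z : ℂ, ‖z‖ < 1 → p z = 0 := by
    intro z hz
    rw [← norm_eq_zero]
    refine le_antisymm (le_of_forall_pos_le_add fun ε hε => ?_) (norm_nonneg _)
    obtain ⟨R₀, hR₀⟩ := hfar (ε / 2) (half_pos hε)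
    -- R ≥ 2 and ‖z‖ < 1 give |t − z| ≥ R/2 on |t| = R, so the integral is at most R (R/2)⁻¹ (ε/2) =
    -- ε.
    set R := max R₀ 2 with hR
    have hR2 : 2 ≤ R := le_max_right _ _
    have hdc : DiffContOnCl ℂ p (Metric.ball 0 1) :=
      ⟨hp', by rwa [closure_ball _ one_ne_zero]⟩
    have h1 := hdc.two_pi_i_inv_smul_circleIntegral_sub_inv_smul (w := z) (by simpa using hz)
    have h2 : (∮ t in C(0, 1), (t - z)⁻¹ • p t) = ∮ t in C(0, 1), (t - z)⁻¹ • q t := by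
      refine circleIntegral.integral_congr zero_le_one fun t ht => ?_
      simp only [hpq t (by simpa using ht)]
    have hne : ∀ t : ℂ, 1 ≤ ‖t‖ → t - z ≠ 0 := by
      intro t ht hc
      rw [sub_eq_zero] at hc
      rw [hc] at ht
      linarith
    have h3 : (∮ t in C(0, R), (t - z)⁻¹ • q t) = ∮ t in C(0, 1), (t - z)⁻¹ • q t := by
      refine Complex.circleIntegral_eq_of_differentiable_on_annulus_off_countable one_pos
        (by linarith) Set.countable_empty ?_ ?_
      · have hsub : Metric.closedBall (0 : ℂ) R \ Metric.ball 0 1 ⊆ {z : ℂ | 1 ≤ ‖z‖} := by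
          intro t ht
          simpa using ht.2
        exact ((continuousOn_id.sub continuousOn_const).inv₀
          fun t ht => hne t (hsub ht)).smul (hq.mono hsub)
      · intro t ht
        have ht1 : 1 < ‖t‖ := by simpa using ht.1.2
        exact ((differentiableAt_id.sub_const z).inv (hne t ht1.le)).smul
          (hq'.differentiableAt (hopen.mem_nhds ht1))
    rw [h2, ← h3] at h1
    rw [← h1, zero_add]
    refine (circleIntegral.norm_two_pi_i_inv_smul_integral_le_of_norm_le_const
      (by linarith : 0 ≤ R) (C := (R / 2)⁻¹ * (ε / 2)) fun t ht => ?_).trans (le_of_eq ?_)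
    · have htR : ‖t‖ = R := by simpa using ht
      have h4 : R / 2 ≤ ‖t - z‖ := by
        have := norm_sub_norm_le t z
        linarith
      have h5 := hR₀ t (htR ▸ le_max_left _ _)
      rw [norm_smul, norm_inv]
      gcongr
    · field_simp
  have hin' : ∀ z : ℂ, ‖z‖ ≤ 1 → p z = 0 := by
    intro z hz
    have h1 : Set.EqOn p 0 (Metric.ball 0 1) := fun t ht => hin t (by simpa using ht)
    refine h1.of_subset_closure hp continuousOn_const Metric.ball_subset_closedBall ?_
      (by simpa using hz)
    rw [closure_ball _ one_ne_zero]
  refine ⟨hin', fun z hz => ?_⟩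
  rw [← norm_eq_zero]
  refine le_antisymm (le_of_forall_pos_le_add fun ε hε => ?_) (norm_nonneg _)
  obtain ⟨R₀, hR₀⟩ := hfar ε hε
  rw [zero_add]
  rcases le_or_gt R₀ ‖z‖ with h | h
  · exact hR₀ z h
  have hU : IsOpen (Metric.ball (0 : ℂ) R₀ \ Metric.closedBall 0 1) :=
    Metric.isOpen_ball.sdiff Metric.isClosed_closedBall
  have hcl : closure (Metric.ball (0 : ℂ) R₀ \ Metric.closedBall 0 1)
      ⊆ {z : ℂ | ‖z‖ ≤ R₀ ∧ 1 ≤ ‖z‖} := by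
    refine closure_minimal (fun t ht => ⟨?_, ?_⟩)
      ((isClosed_le continuous_norm continuous_const).inter
        (isClosed_le continuous_const continuous_norm))
    · exact (show ‖t‖ < R₀ by simpa using ht.1).le
    · exact (show 1 < ‖t‖ by simpa using ht.2).le
  rcases eq_or_lt_of_le hz with h1 | h1
  · rw [← hpq z h1.symm, hin' z h1.symm.le, norm_zero]
    exact hε.le
  -- On the annulus 1 < |t| < R₀ the boundary values are 0 on the inner circle and at most ε on the
  -- outer one.
  refine Complex.norm_le_of_forall_mem_frontier_norm_le
    (U := Metric.ball (0 : ℂ) R₀ \ Metric.closedBall 0 1)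
    (Metric.isBounded_ball.subset Set.sdiff_subset)
    ⟨hq'.mono fun t ht => by simpa using ht.2, hq.mono fun t ht => (hcl ht).2⟩ (fun t ht => ?_)
    (subset_closure ⟨by simpa using h, by simpa using h1⟩)
  have ht1 := hcl (frontier_subset_closure ht)
  rcases eq_or_lt_of_le ht1.2 with h2 | h2
  · rw [← hpq t h2.symm, hin' t h2.symm.le, norm_zero]
    exact hε.le
  · refine hR₀ t (le_of_not_gt fun h3 => ?_)
    rw [hU.frontier_eq] at ht
    exact ht.2 ⟨by simpa using h3, by simpa using h2⟩

open scoped Matrix.Norms.L2Operator ComplexConjugate Matrix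

/-- The two conjugations in G(z̄)ᴴ cancel, leaving a holomorphic function. -/
theorem differentiableAt_mul_conjTranspose_conj {n : Type*} [Fintype n] [DecidableEq n]
    {G : ℂ → Matrix n n ℂ} {z : ℂ} (h1 : DifferentiableAt ℂ G z)
    (h2 : DifferentiableAt ℂ G (conj z)) :
    DifferentiableAt ℂ (fun w => G w * (G (conj w))ᴴ) z :=
  h1.mul (differentiableAt_star_conj_iff.2 h2)

/-- A vanishing lemma for Riemann–Hilbert problems on the unit circle whose jump matrix has the
Schwarz symmetry `V(z) V(z̄)ᴴ = 1`: the homogeneous problem only has the trivial solution. -/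
theorem vanishing_of_schwarz_symmetric {n : Type*} [Fintype n] [DecidableEq n]
    {G D V : ℂ → Matrix n n ℂ}
    (hG : ContinuousOn G (Metric.closedBall 0 1)) (hG' : DifferentiableOn ℂ G (Metric.ball 0 1))
    (hD : ContinuousOn D {z : ℂ | 1 ≤ ‖z‖}) (hD' : DifferentiableOn ℂ D {z : ℂ | 1 < ‖z‖})
    (hD0 : Tendsto D (Bornology.cobounded ℂ) (𝓝 0))
    (hV : ∀ z : ℂ, ‖z‖ = 1 → V z * (V (conj z))ᴴ = 1)
    (hGD : ∀ z : ℂ, ‖z‖ = 1 → G z = D z * V z) :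
    (∀ z : ℂ, ‖z‖ ≤ 1 → G z = 0) ∧ ∀ z : ℂ, 1 ≤ ‖z‖ → D z = 0 := by
  have hopen : IsOpen {z : ℂ | 1 < ‖z‖} := isOpen_lt continuous_const continuous_norm
  have hstar : ∀ {S : Set ℂ} {F : ℂ → Matrix n n ℂ}, ContinuousOn F S →
      (∀ z ∈ S, conj z ∈ S) → ContinuousOn (fun w => F w * (F (conj w))ᴴ) S := by
    intro S F hF hS
    exact hF.mul ((hF.comp Complex.continuous_conj.continuousOn hS).star)
  have hH := eq_zero_of_eqOn_circle (p := fun w => G w * (G (conj w))ᴴ)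
    (q := fun w => D w * (D (conj w))ᴴ)
    (hstar hG fun z hz => by simpa using hz)
    (fun z hz => (differentiableAt_mul_conjTranspose_conj
      (hG'.differentiableAt (Metric.isOpen_ball.mem_nhds hz))
      (hG'.differentiableAt (Metric.isOpen_ball.mem_nhds
        (by simpa using hz)))).differentiableWithinAt)
    (hstar hD fun z hz => by simpa using hz)
    (fun z hz => (differentiableAt_mul_conjTranspose_conj
      (hD'.differentiableAt (hopen.mem_nhds hz))
      (hD'.differentiableAt (hopen.mem_nhds (by simpa using hz)))).differentiableWithinAt)
    (by
      have hconj : Tendsto (fun z : ℂ => conj z) (Bornology.cobounded ℂ)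
          (Bornology.cobounded ℂ) := by
        rw [← tendsto_norm_atTop_iff_cobounded]
        simpa using tendsto_norm_cobounded_atTop (E := ℂ)
      have h2 : Tendsto (fun w : ℂ => star (D (conj w))) (Bornology.cobounded ℂ) (𝓝 0) := by
        simpa using (hD0.comp hconj).star
      have h3 := hD0.mul h2
      rw [mul_zero] at h3
      exact h3)
    (fun z hz => by
      have hz' : ‖conj z‖ = 1 := by simpa using hz
      simp only [hGD z hz, hGD _ hz', Matrix.conjTranspose_mul]
      rw [Matrix.mul_assoc, ← Matrix.mul_assoc (V z), hV z hz, Matrix.one_mul])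
  -- At a real point the vanishing product is G Gᴴ, and the C*-identity applies.
  have hreal : ∀ x : ℝ, |x| ≤ 1 → G x = 0 := by
    intro x hx
    have := hH.1 x (by simpa using hx)
    rw [Complex.conj_ofReal] at this
    exact CStarRing.mul_star_self_eq_zero_iff _ |>.1 this
  have hfreq : ∃ᶠ z : ℂ in 𝓝[≠] 0, G z = 0 := by
    have h1 : Tendsto (fun x : ℝ => (x : ℂ)) (𝓝[≠] 0) (𝓝[≠] 0) := by
      refine tendsto_nhdsWithin_iff.2 ⟨?_, ?_⟩
      · exact (Complex.continuous_ofReal.tendsto' 0 0 Complex.ofReal_zero).mono_left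
          nhdsWithin_le_nhds
      · filter_upwards [self_mem_nhdsWithin] with x hx
        simpa using hx
    refine h1.frequently (Eventually.frequently ?_)
    have : ∀ᶠ x : ℝ in 𝓝 0, |x| < 1 :=
      (continuous_abs.tendsto (0 : ℝ)).eventually_lt_const (by simp)
    filter_upwards [nhdsWithin_le_nhds this] with x hx
    exact hreal x hx.le
  have hG0 : Set.EqOn G 0 (Metric.ball 0 1) :=
    (hG'.analyticOnNhd Metric.isOpen_ball).eqOn_zero_of_preconnected_of_frequently_eq_zero
      (convex_ball (0 : ℂ) 1).isPreconnected (Metric.mem_ball_self one_pos) hfreq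
  have hG1 : ∀ z : ℂ, ‖z‖ ≤ 1 → G z = 0 := by
    intro z hz
    refine hG0.of_subset_closure hG continuousOn_const Metric.ball_subset_closedBall ?_
      (by simpa using hz)
    rw [closure_ball _ one_ne_zero]
  refine ⟨hG1, ?_⟩
  refine (eq_zero_of_eqOn_circle (p := 0) continuousOn_const (differentiableOn_const 0) hD hD' hD0
    fun z hz => ?_).2
  have h1 : D z * V z = 0 := by rw [← hGD z hz, hG1 z hz.le]
  have h2 : D z = D z * V z * (V (conj z))ᴴ := by rw [Matrix.mul_assoc, hV z hz, Matrix.mul_one]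
  rw [h2, h1, Matrix.zero_mul]
  rfl

end Vanishing

/-! ### The integral equation as a Fredholm problem. -/

theorem continuousAt_clm_inverse {E : Type*} [NormedAddCommGroup E] [NormedSpace ℂ E]
    [CompleteSpace E] {T : E →L[ℂ] E} (hT : IsUnit T) :
    ContinuousAt (Ring.inverse : (E →L[ℂ] E) → E →L[ℂ] E) T := by
  obtain ⟨u, rfl⟩ := hT
  exact NormedRing.inverse_continuousAt u

section CauchyOperators

variable {𝔸 : Type*} [NormedRing 𝔸] [NormedAlgebra ℂ 𝔸]

theorem cauchyTransform_congr {r : ℝ} (hr : 0 ≤ r) {g h : ℂ → 𝔸}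
    (hgh : Set.EqOn g h (Metric.sphere 0 r)) : cauchyTransform r g = cauchyTransform r h := by
  ext z
  rw [cauchyTransform, cauchyTransform]
  congr 1
  refine circleIntegral.integral_congr hr fun t ht => ?_
  simp only [hgh ht]

/-- The candidate solution inside the disc of radius `b`. -/
noncomputable def innerPart (b : ℝ) (W f : ℂ → 𝔸) : ℂ → 𝔸 :=
  cauchyTransform b (fun t => f t * W t)

/-- The candidate solution outside the disc of radius `a`. -/
noncomputable def outerPart (a b : ℝ) (W V : ℂ → 𝔸) (M : 𝔸) (f : ℂ → 𝔸) : ℂ → 𝔸 :=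
  fun z => M - cauchyTransform a (fun t => innerPart b W f t * V t) z

/-- Right multiplication by a fixed element of a Banach algebra, as a continuous linear function of
that element. -/
noncomputable def mulRightCLM (A : Type*) [NormedRing A] [NormedAlgebra ℂ A] : A →L[ℂ] A →L[ℂ] A :=
  (ContinuousLinearMap.mul ℂ A).flip

@[simp]
theorem mulRightCLM_apply {A : Type*} [NormedRing A] [NormedAlgebra ℂ A] (w f : A) :
    mulRightCLM A w f = f * w := rfl

variable [CompleteSpace 𝔸]

/-- The operator `f ↦ C_{a → b}(C_{b → a}(f w) v)` on continuous functions on the circle of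
radius `b`, where `C_{r → s}` denotes the Cauchy transform from radius `r` to radius `s`. -/
noncomputable def jumpOp {a b : ℝ} (ha : 0 ≤ a) (hab : a < b)
    (w : C(Metric.sphere (0 : ℂ) b, 𝔸)) (v : C(Metric.sphere (0 : ℂ) a, 𝔸)) :
    C(Metric.sphere (0 : ℂ) b, 𝔸) →L[ℂ] C(Metric.sphere (0 : ℂ) b, 𝔸) :=
  (cauchyOp 𝔸 ha hab.ne').comp ((mulRightCLM _ v).comp
    ((cauchyOp 𝔸 (ha.trans hab.le) hab.ne).comp (mulRightCLM _ w)))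

theorem isCompactOperator_jumpOp [FiniteDimensional ℂ 𝔸] {a b : ℝ} (ha : 0 ≤ a) (hab : a < b)
    (w : C(Metric.sphere (0 : ℂ) b, 𝔸)) (v : C(Metric.sphere (0 : ℂ) a, 𝔸)) :
    IsCompactOperator (jumpOp ha hab w v) :=
  (isCompactOperator_cauchyOp (𝔸 := 𝔸) ha hab.ne').comp_clm ((mulRightCLM _ v).comp
    ((cauchyOp 𝔸 (ha.trans hab.le) hab.ne).comp (mulRightCLM _ w)))

theorem continuous_jumpOp {P : Type*} [TopologicalSpace P] {a b : ℝ} (ha : 0 ≤ a) (hab : a < b)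
    {w : P → C(Metric.sphere (0 : ℂ) b, 𝔸)} {v : P → C(Metric.sphere (0 : ℂ) a, 𝔸)}
    (hw : Continuous w) (hv : Continuous v) :
    Continuous fun p => jumpOp ha hab (w p) (v p) := by
  have h1 : Continuous fun p => mulRightCLM _ (w p) := (mulRightCLM _).continuous.comp hw
  have h2 : Continuous fun p => mulRightCLM _ (v p) := (mulRightCLM _).continuous.comp hv
  exact continuous_const.clm_comp (h2.clm_comp (continuous_const.clm_comp h1))

/-- Identifies the operator equation (1 + K) f = M with the trace condition f = F on the circle of
radius `b`. -/
theorem sub_jumpOp_apply {a b : ℝ} (ha : 0 ≤ a) (hab : a < b)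
    {w : C(Metric.sphere (0 : ℂ) b, 𝔸)} {v : C(Metric.sphere (0 : ℂ) a, 𝔸)}
    {W V : ℂ → 𝔸} (hw : ∀ t, w t = W t) (hv : ∀ t, v t = V t)
    (f : C(Metric.sphere (0 : ℂ) b, 𝔸)) (M : 𝔸) (z : Metric.sphere (0 : ℂ) b) :
    M - jumpOp ha hab w v f z = outerPart a b W V M (circleExtend f) z := by
  rw [outerPart]
  congr 1
  refine cauchyOp_apply ha hab.ne' _ z (g := fun t => innerPart b W (circleExtend f) t * V t)
    fun t => ?_
  have h1 := cauchyOp_apply (ha.trans hab.le) hab.ne (mulRightCLM _ w f) t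
    (g := fun t => circleExtend f t * W t) fun s => by
      rw [mulRightCLM_apply, ContinuousMap.mul_apply, hw, circleExtend_apply f s.2]
  change cauchyOp 𝔸 (ha.trans hab.le) hab.ne (mulRightCLM _ w f) t * v t = _
  rw [hv, h1]
  rfl

/-- Fredholm alternative at −1: either −1 is an eigenvalue of the compact operator, and its
eigenvector contradicts `hinj`, or it lies in the resolvent set. -/
theorem isUnit_one_add_jumpOp [FiniteDimensional ℂ 𝔸] {a b : ℝ} (ha : 0 ≤ a) (hab : a < b)
    {w : C(Metric.sphere (0 : ℂ) b, 𝔸)} {v : C(Metric.sphere (0 : ℂ) a, 𝔸)}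
    {W V : ℂ → 𝔸} (hw : ∀ t, w t = W t) (hv : ∀ t, v t = V t)
    (hinj : ∀ f : ℂ → 𝔸, ContinuousOn f (Metric.sphere 0 b) →
      (∀ z ∈ Metric.sphere (0 : ℂ) b, f z = outerPart a b W V 0 f z) →
      ∀ z ∈ Metric.sphere (0 : ℂ) b, f z = 0) :
    IsUnit (1 + jumpOp ha hab w v) := by
  rcases IsCompactOperator.hasEigenvalue_or_mem_resolventSet
    (isCompactOperator_jumpOp ha hab w v) (neg_ne_zero.2 (one_ne_zero (α := ℂ))) with h1 | h1
  · exfalso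
    obtain ⟨f, hf⟩ := h1.exists_hasEigenvector
    refine hf.2 (ContinuousMap.ext fun z => ?_)
    have h2 : jumpOp ha hab w v f = (-1 : ℂ) • f := hf.apply_eq_smul
    have h3 := hinj _ (continuousOn_circleExtend f) (fun z hz => ?_) z z.2
    · rwa [circleExtend_apply f z.2] at h3
    · rw [← sub_jumpOp_apply ha hab hw hv f 0 ⟨z, hz⟩, h2, circleExtend_apply f hz]
      simp
  · rw [spectrum.mem_resolventSet_iff] at h1
    rw [← IsUnit.neg_iff]
    convert h1 using 1
    rw [map_neg, map_one]
    abel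

/-- Solvability of a continuous family of integral equations without homogeneous solutions, with
local boundedness in the parameter. -/
theorem exists_bounded_integralEquation_solution [FiniteDimensional ℂ 𝔸] {P : Type*}
    [TopologicalSpace P] {ρ a b : ℝ} (ha : 0 ≤ a) (hρ : ρ < a) (hab : a < b) {W V : P → ℂ → 𝔸}
    (hW : ContinuousOn (Function.uncurry W) {x | ρ < ‖x.2‖})
    (hV : ContinuousOn (Function.uncurry V) {x | ρ < ‖x.2‖})
    (hinj : ∀ p, ∀ f : ℂ → 𝔸, ContinuousOn f (Metric.sphere 0 b) →
      (∀ z ∈ Metric.sphere (0 : ℂ) b, f z = outerPart a b (W p) (V p) 0 f z) →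
      ∀ z ∈ Metric.sphere (0 : ℂ) b, f z = 0) (M : 𝔸) :
    ∃ f : P → ℂ → 𝔸, (∀ p, ContinuousOn (f p) (Metric.sphere 0 b)) ∧
      (∀ p, ∀ z ∈ Metric.sphere (0 : ℂ) b, f p z = outerPart a b (W p) (V p) M (f p) z) ∧
      ∀ S : Set P, IsCompact S → ∃ A : ℝ, 0 ≤ A ∧ ∀ p ∈ S,
        (∀ z ∈ Metric.sphere (0 : ℂ) b, ‖f p z‖ ≤ A ∧ ‖W p z‖ ≤ A) ∧
        ∀ z ∈ Metric.sphere (0 : ℂ) a, ‖V p z‖ ≤ A := by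
  have hcont : ∀ {r : ℝ} {U : P → ℂ → 𝔸}, ρ < r →
      ContinuousOn (Function.uncurry U) {x | ρ < ‖x.2‖} →
      Continuous fun x : P × Metric.sphere (0 : ℂ) r => U x.1 x.2 := by
    intro r U hr hU
    refine hU.comp_continuous (f := fun x : P × Metric.sphere (0 : ℂ) r => (x.1, (x.2 : ℂ)))
      (by fun_prop) fun x => ?_
    rw [Set.mem_ofPred_eq, mem_sphere_zero_iff_norm.1 x.2.2]
    exact hr
  have hWb := hcont (hρ.trans hab) hW
  have hVa := hcont hρ hV
  let w : P → C(Metric.sphere (0 : ℂ) b, 𝔸) := fun p =>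
    ⟨fun t => W p t, hWb.comp (Continuous.prodMk_right p)⟩
  let v : P → C(Metric.sphere (0 : ℂ) a, 𝔸) := fun p =>
    ⟨fun t => V p t, hVa.comp (Continuous.prodMk_right p)⟩
  have hw : Continuous w := ContinuousMap.continuous_of_continuous_uncurry w hWb
  have hv : Continuous v := ContinuousMap.continuous_of_continuous_uncurry v hVa
  let T := fun p => 1 + jumpOp ha hab (w p) (v p)
  have hT : Continuous T := continuous_const.add (continuous_jumpOp ha hab hw hv)
  have hunit : ∀ p, IsUnit (T p) := fun p =>
    isUnit_one_add_jumpOp ha hab (fun _ => rfl) (fun _ => rfl) (hinj p)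
  let m : C(Metric.sphere (0 : ℂ) b, 𝔸) := ContinuousMap.const _ M
  let f : P → C(Metric.sphere (0 : ℂ) b, 𝔸) := fun p => Ring.inverse (T p) m
  -- Inversion is continuous at units, so the solution depends continuously on the parameter; the
  -- bounds over compact sets rest on this.
  have hf : Continuous f := by
    refine Continuous.clm_apply (continuous_iff_continuousAt.2 fun p => ?_) continuous_const
    exact ContinuousAt.comp (continuousAt_clm_inverse (hunit p)) hT.continuousAt
  refine ⟨fun p => circleExtend (f p), fun p => continuousOn_circleExtend (f p),
    fun p z hz => ?_, fun S hS => ?_⟩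
  · change circleExtend (f p) z = outerPart a b (W p) (V p) M (circleExtend (f p)) z
    rw [← sub_jumpOp_apply ha hab (w := w p) (v := v p) (fun _ => rfl) (fun _ => rfl) (f p) M
      ⟨z, hz⟩, circleExtend_apply _ hz, eq_sub_iff_add_eq]
    have h1 : T p (f p) = m :=
      congrArg (fun L => L m) (Ring.mul_inverse_cancel _ (hunit p))
    exact congrArg (fun g : C(Metric.sphere (0 : ℂ) b, 𝔸) => g ⟨z, hz⟩) h1
  · obtain ⟨A, hA⟩ := hS.exists_bound_of_continuousOn hf.continuousOn
    obtain ⟨B, hB⟩ := hS.exists_bound_of_continuousOn hw.continuousOn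
    obtain ⟨B', hB'⟩ := hS.exists_bound_of_continuousOn hv.continuousOn
    refine ⟨|A| + |B| + |B'|, by positivity, fun p hp =>
      ⟨fun z hz => ⟨?_, ?_⟩, fun z hz => ?_⟩⟩
    · change ‖circleExtend (f p) z‖ ≤ _
      rw [circleExtend_apply _ hz]
      refine (((f p).norm_coe_le_norm ⟨z, hz⟩).trans (hA p hp)).trans ?_
      linarith [le_abs_self A, abs_nonneg B, abs_nonneg B']
    · refine (((w p).norm_coe_le_norm ⟨z, hz⟩).trans (hB p hp)).trans ?_
      linarith [le_abs_self B, abs_nonneg A, abs_nonneg B']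
    · refine (((v p).norm_coe_le_norm ⟨z, hz⟩).trans (hB' p hp)).trans ?_
      linarith [le_abs_self B', abs_nonneg A, abs_nonneg B]

end CauchyOperators

/-! ### From the integral equation to the Riemann–Hilbert problem. -/

section IntegralEquation

open scoped Matrix.Norms.L2Operator ComplexConjugate Matrix

variable {n : Type*} [Fintype n] [DecidableEq n]

/-- Data for a Riemann–Hilbert problem on the unit circle: a jump matrix `W` with inverse `V`, both
analytic for `‖z‖ > ρ`, with the Schwarz symmetry `W(z) W(z̄)ᴴ = 1` on the circle, and auxiliary
radii `ρ < a < 1 < b`. -/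
structure IsJumpData (ρ a b : ℝ) (W V : ℂ → Matrix n n ℂ) : Prop where
  nonneg : 0 ≤ ρ
  lt_a : ρ < a
  a_lt : a < 1
  lt_b : 1 < b
  diff_W : DifferentiableOn ℂ W {z : ℂ | ρ < ‖z‖}
  diff_V : DifferentiableOn ℂ V {z : ℂ | ρ < ‖z‖}
  mul_inv : ∀ z : ℂ, ρ < ‖z‖ → W z * V z = 1
  symm : ∀ z : ℂ, ‖z‖ = 1 → W z * (W (conj z))ᴴ = 1

namespace IsJumpData

variable {ρ a b : ℝ} {W V : ℂ → Matrix n n ℂ} {f : ℂ → Matrix n n ℂ} {M : Matrix n n ℂ}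

theorem a_pos (h : IsJumpData ρ a b W V) : 0 < a := h.nonneg.trans_lt h.lt_a

theorem b_pos (h : IsJumpData ρ a b W V) : 0 < b := zero_lt_one.trans h.lt_b

/-- On the circle V(z) = W(z̄)ᴴ. The symmetry of `V` lets the vanishing lemma run with jump `V` when
the jump relation is proved. -/
theorem inv_symm (h : IsJumpData ρ a b W V) (z : ℂ) (hz : ‖z‖ = 1) :
    V z * (V (conj z))ᴴ = 1 := by
  have hρ : ρ < 1 := h.lt_a.trans h.a_lt
  have hz' : ‖conj z‖ = 1 := by simpa using hz
  have key : ∀ w : ℂ, ‖w‖ = 1 → V w = (W (conj w))ᴴ := by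
    intro w hw
    have h1 : V w * W w = 1 := mul_eq_one_comm.1 (h.mul_inv w (hw ▸ hρ))
    calc V w = V w * (W w * (W (conj w))ᴴ) := by rw [h.symm w hw, mul_one]
      _ = (W (conj w))ᴴ := by rw [← mul_assoc, h1, one_mul]
  rw [key z hz, key _ hz', Complex.conj_conj, Matrix.conjTranspose_conjTranspose]
  exact mul_eq_one_comm.1 (h.symm z hz)

theorem isOpen_norm_gt (r : ℝ) : IsOpen {z : ℂ | r < ‖z‖} :=
  isOpen_lt continuous_const continuous_norm

theorem differentiableAt_innerPart (h : IsJumpData ρ a b W V)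
    (hf : ContinuousOn f (Metric.sphere 0 b)) {z : ℂ} (hz : ‖z‖ < b) :
    DifferentiableAt ℂ (innerPart b W f) z := by
  refine differentiableAt_cauchyTransform h.b_pos.le (hf.mul (h.diff_W.continuousOn.mono ?_)) hz.ne
  intro t ht
  rw [mem_sphere_zero_iff_norm] at ht
  rw [Set.mem_ofPred_eq, ht]
  linarith [h.lt_a, h.a_lt, h.lt_b]

theorem differentiableOn_innerPart_mul (h : IsJumpData ρ a b W V)
    (hf : ContinuousOn f (Metric.sphere 0 b)) :
    DifferentiableOn ℂ (fun t => innerPart b W f t * V t) {z : ℂ | ρ < ‖z‖ ∧ ‖z‖ < b} :=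
  fun _ hz => ((h.differentiableAt_innerPart hf hz.2).mul (h.diff_V.differentiableAt
    ((isOpen_norm_gt ρ).mem_nhds hz.1))).differentiableWithinAt

theorem continuousOn_innerPart_mul (h : IsJumpData ρ a b W V)
    (hf : ContinuousOn f (Metric.sphere 0 b)) :
    ContinuousOn (fun t => innerPart b W f t * V t) (Metric.sphere 0 a) := by
  refine (h.differentiableOn_innerPart_mul hf).continuousOn.mono fun t ht => ?_
  rw [mem_sphere_zero_iff_norm] at ht
  rw [Set.mem_ofPred_eq, ht]
  exact ⟨h.lt_a, h.a_lt.trans h.lt_b⟩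

theorem differentiableAt_outerPart (h : IsJumpData ρ a b W V)
    (hf : ContinuousOn f (Metric.sphere 0 b)) {z : ℂ} (hz : a < ‖z‖) :
    DifferentiableAt ℂ (outerPart a b W V M f) z :=
  (differentiableAt_const M).sub (differentiableAt_cauchyTransform h.a_pos.le
    (h.continuousOn_innerPart_mul hf) hz.ne')

theorem outerPart_sub_isBigO (h : IsJumpData ρ a b W V)
    (hf : ContinuousOn f (Metric.sphere 0 b)) :
    (fun z => outerPart a b W V M f z - M) =O[Bornology.cobounded ℂ] (fun z : ℂ => z⁻¹) := by
  have := (cauchyTransform_isBigO h.a_pos.le (h.continuousOn_innerPart_mul hf)).neg_left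
  refine this.congr_left fun z => ?_
  simp only [outerPart]
  abel

/-- A solution of the integral equation solves the jump relation. -/
theorem innerPart_eq_outerPart_mul (h : IsJumpData ρ a b W V)
    (hf : ContinuousOn f (Metric.sphere 0 b))
    (heq : ∀ z ∈ Metric.sphere (0 : ℂ) b, f z = outerPart a b W V M f z) (z : ℂ) (hz : ‖z‖ = 1) :
    innerPart b W f z = outerPart a b W V M f z * W z := by
  have hρ := h.nonneg
  have hρa := h.lt_a
  have ha1 := h.a_lt
  have hb1 := h.lt_b
  have ha := h.a_pos
  have hb := h.b_pos
  set E₀ := innerPart b W f with hE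
  set F₀ := outerPart a b W V M f with hF
  set k : ℂ → Matrix n n ℂ := fun t => E₀ t * V t with hk
  set g : ℂ → Matrix n n ℂ := fun t => F₀ t * W t with hg
  have hgd : DifferentiableOn ℂ g {z : ℂ | a < ‖z‖} := fun t ht =>
    ((h.differentiableAt_outerPart hf ht).mul (h.diff_W.differentiableAt
      ((isOpen_norm_gt ρ).mem_nhds (hρa.trans ht)))).differentiableWithinAt
  have hkd : DifferentiableOn ℂ k {z : ℂ | ρ < ‖z‖ ∧ ‖z‖ < b} :=
    h.differentiableOn_innerPart_mul hf
  have hEg : E₀ = cauchyTransform b g :=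
    cauchyTransform_congr hb.le fun t ht => by simp only [hg, heq t ht]
  -- The radii a < c < 1 < d < b leave room to move contours across the unit circle: `g` is analytic
  -- for |t| > a, `k` for ρ < |t| < b.
  obtain ⟨c, hac, hc1⟩ := exists_between ha1
  obtain ⟨d, h1d, hdb⟩ := exists_between hb1
  have hc := ha.trans hac
  have hd := zero_lt_one.trans h1d
  have hD : ∀ t : ℂ, c < ‖t‖ → ‖t‖ < b → E₀ t - cauchyTransform c g t = F₀ t * W t := by
    intro t h1 h2
    rw [hEg]
    refine cauchyTransform_sub_cauchyTransform hc (isOpen_norm_gt a) hgd ?_ h1 h2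
    intro w hw
    have : c ≤ ‖w‖ := by simpa using hw.2
    exact hac.trans_le this
  have hG : ∀ t : ℂ, a < ‖t‖ → ‖t‖ < d →
      cauchyTransform d k t - cauchyTransform a k t = k t := by
    intro t h1 h2
    refine cauchyTransform_sub_cauchyTransform ha ((isOpen_norm_gt ρ).inter
      (isOpen_lt continuous_norm continuous_const)) hkd ?_ h1 h2
    intro w hw
    have h3 : a ≤ ‖w‖ := by simpa using hw.2
    have h4 : ‖w‖ ≤ d := by simpa using hw.1
    exact ⟨hρa.trans_le h3, h4.trans_lt hdb⟩
  have hgc : ContinuousOn g (Metric.sphere 0 c) := hgd.continuousOn.mono fun t ht => by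
    rw [mem_sphere_zero_iff_norm] at ht
    rw [Set.mem_ofPred_eq, ht]
    exact hac
  have hkc : ContinuousOn k (Metric.sphere 0 d) := hkd.continuousOn.mono fun t ht => by
    rw [mem_sphere_zero_iff_norm] at ht
    rw [Set.mem_ofPred_eq, ht]
    exact ⟨by linarith, hdb⟩
  have hdG : ∀ t : ℂ, ‖t‖ < d → DifferentiableAt ℂ (fun t => cauchyTransform d k t - M) t :=
    fun t ht => (differentiableAt_cauchyTransform hd.le hkc ht.ne).sub_const M
  have hdD : ∀ t : ℂ, c < ‖t‖ → DifferentiableAt ℂ (cauchyTransform c g) t :=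
    fun t ht => differentiableAt_cauchyTransform hc.le hgc ht.ne'
  -- Near the circle C_c g = E₀ − F₀ W and C_d k − M = E₀ V − F₀. The second is the first times `V`,
  -- so the defect of the jump relation solves a homogeneous problem.
  have hvan := vanishing_of_schwarz_symmetric (G := fun t => cauchyTransform d k t - M)
    (D := cauchyTransform c g) (V := V)
    (fun t ht => (hdG t ((mem_closedBall_zero_iff.1 ht).trans_lt
      h1d)).continuousAt.continuousWithinAt)
    (fun t ht => (hdG t ((mem_ball_zero_iff.1 ht).trans h1d)).differentiableWithinAt)
    (fun t ht => (hdD t (hc1.trans_le ht)).continuousAt.continuousWithinAt)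
    (fun t ht => (hdD t (hc1.trans ht)).differentiableWithinAt)
    ((cauchyTransform_isBigO hc.le hgc).trans_tendsto tendsto_inv₀_cobounded)
    h.inv_symm
    (fun t ht => by
      have h1 := hD t (by linarith) (by linarith)
      have h2 := hG t (by linarith) (by linarith)
      have h3 : cauchyTransform c g t = E₀ t - F₀ t * W t := by rw [← h1]; abel
      have h4 : cauchyTransform d k t = E₀ t * V t + cauchyTransform a k t := by
        rw [sub_eq_iff_eq_add.1 h2]
      rw [h3, h4, sub_mul, mul_assoc, h.mul_inv t (by linarith), mul_one]
      simp only [hF, outerPart, hk, hE]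
      abel)
  have h1 := hD z (by linarith) (by linarith)
  rwa [hvan.2 z hz.ge, sub_zero] at h1

/-- For M = 0 the inner and outer parts solve the homogeneous problem with jump `W`. This supplies
the injectivity for the Fredholm alternative. -/
theorem eq_zero_of_homogeneous (h : IsJumpData ρ a b W V)
    (hf : ContinuousOn f (Metric.sphere 0 b))
    (heq : ∀ z ∈ Metric.sphere (0 : ℂ) b, f z = outerPart a b W V 0 f z) (z : ℂ)
    (hz : z ∈ Metric.sphere (0 : ℂ) b) : f z = 0 := by
  have ha1 := h.a_lt
  have hb1 := h.lt_b
  have hvan := vanishing_of_schwarz_symmetric (G := innerPart b W f)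
    (D := outerPart a b W V 0 f) (V := W)
    (fun t ht => (h.differentiableAt_innerPart hf ((mem_closedBall_zero_iff.1 ht).trans_lt
      hb1)).continuousAt.continuousWithinAt)
    (fun t ht => (h.differentiableAt_innerPart hf ((mem_ball_zero_iff.1 ht).trans
      hb1)).differentiableWithinAt)
    (fun t ht => (h.differentiableAt_outerPart hf (ha1.trans_le ht)).continuousAt.continuousWithinAt)
    (fun t ht => (h.differentiableAt_outerPart hf (ha1.trans ht)).differentiableWithinAt)
    (by
      have := (h.outerPart_sub_isBigO (M := 0) hf).trans_tendsto tendsto_inv₀_cobounded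
      simpa only [sub_zero] using this)
    h.symm (h.innerPart_eq_outerPart_mul hf heq)
  rw [heq z hz]
  exact hvan.2 z (by rw [mem_sphere_zero_iff_norm.1 hz]; exact hb1.le)

theorem norm_innerPart_le (h : IsJumpData ρ a b W V) {A B : ℝ}
    (hf : ∀ t ∈ Metric.sphere (0 : ℂ) b, ‖f t‖ ≤ A)
    (hW : ∀ t ∈ Metric.sphere (0 : ℂ) b, ‖W t‖ ≤ B) (hA : 0 ≤ A) {z : ℂ} (hz : ‖z‖ ≤ 1) :
    ‖innerPart b W f z‖ ≤ b * ((b - 1)⁻¹ * (A * B)) := by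
  refine norm_cauchyTransform_le h.b_pos.le (sub_pos.2 h.lt_b)
    (le_abs.2 (Or.inl (by linarith))) fun t ht => (norm_mul_le _ _).trans ?_
  have h1 := hf t ht
  have h2 := hW t ht
  gcongr

theorem norm_outerPart_le (h : IsJumpData ρ a b W V) {A B : ℝ}
    (hE : ∀ t ∈ Metric.sphere (0 : ℂ) a, ‖innerPart b W f t‖ ≤ A)
    (hV : ∀ t ∈ Metric.sphere (0 : ℂ) a, ‖V t‖ ≤ B) (hA : 0 ≤ A) {z : ℂ} (hz : 1 ≤ ‖z‖) :
    ‖outerPart a b W V M f z‖ ≤ ‖M‖ + a * ((1 - a)⁻¹ * (A * B)) := by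
  refine (norm_sub_le _ _).trans (add_le_add le_rfl ?_)
  refine norm_cauchyTransform_le h.a_pos.le (sub_pos.2 h.a_lt)
    (le_abs.2 (Or.inr (by linarith))) fun t ht => (norm_mul_le _ _).trans ?_
  have h1 := hE t ht
  have h2 := hV t ht
  gcongr

end IsJumpData

/-- A continuous family of Riemann–Hilbert problems with Schwarz-symmetric analytic jump matrices on
the unit circle is solvable, with solutions that are locally uniformly bounded in the parameter. -/
theorem exists_bounded_family {P : Type*} [TopologicalSpace P] {ρ a b : ℝ}
    {W V : P → ℂ → Matrix n n ℂ} (h : ∀ p, IsJumpData ρ a b (W p) (V p)) (ha : 0 ≤ a)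
    (hρ : ρ < a) (hab : a < b)
    (hW : ContinuousOn (Function.uncurry W) {x | ρ < ‖x.2‖})
    (hV : ContinuousOn (Function.uncurry V) {x | ρ < ‖x.2‖}) :
    ∃ E₀ F₀ : P → ℂ → Matrix n n ℂ,
      (∀ p, DifferentiableOn ℂ (E₀ p) (Metric.ball 0 b)) ∧
      (∀ p, DifferentiableOn ℂ (F₀ p) {z : ℂ | a < ‖z‖}) ∧
      (∀ p z, ‖z‖ = 1 → E₀ p z = F₀ p z * W p z) ∧
      (∀ p, (fun z => F₀ p z - 1) =O[Bornology.cobounded ℂ] (fun z : ℂ => z⁻¹)) ∧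
      ∀ S : Set P, IsCompact S → ∃ C : ℝ, ∀ p ∈ S,
        (∀ z : ℂ, ‖z‖ ≤ 1 → ‖E₀ p z‖ ≤ C) ∧ (∀ z : ℂ, 1 ≤ ‖z‖ → ‖F₀ p z‖ ≤ C) := by
  obtain ⟨f, hf, heq, hbd⟩ := exists_bounded_integralEquation_solution ha hρ hab hW hV
    (fun p f hf => (h p).eq_zero_of_homogeneous hf) 1
  refine ⟨fun p => innerPart b (W p) (f p),
    fun p => outerPart a b (W p) (V p) 1 (f p), fun p z hz =>
      ((h p).differentiableAt_innerPart (hf p)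
        (mem_ball_zero_iff.1 hz)).differentiableWithinAt, fun p z hz =>
      ((h p).differentiableAt_outerPart (hf p) hz).differentiableWithinAt,
    fun p z hz => (h p).innerPart_eq_outerPart_mul (hf p) (heq p) z hz,
    fun p => (h p).outerPart_sub_isBigO (hf p), fun S hS => ?_⟩
  obtain ⟨A, hA0, hA⟩ := hbd S hS
  set A' := b * ((b - 1)⁻¹ * (A * A)) with hA'
  refine ⟨max A' (‖(1 : Matrix n n ℂ)‖ + a * ((1 - a)⁻¹ * (A' * A))), fun p hp => ?_⟩
  have hin : ∀ z : ℂ, ‖z‖ ≤ 1 → ‖innerPart b (W p) (f p) z‖ ≤ A' := fun z hz =>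
    (h p).norm_innerPart_le (fun t ht => ((hA p hp).1 t ht).1)
      (fun t ht => ((hA p hp).1 t ht).2) hA0 hz
  have hA'pos : 0 ≤ A' := (norm_nonneg _).trans (hin 0 (by simp))
  refine ⟨fun z hz => (hin z hz).trans (le_max_left _ _), fun z hz =>
    ((h p).norm_outerPart_le (fun t ht => hin t ?_) (hA p hp).2 hA'pos hz).trans
      (le_max_right _ _)⟩
  rw [mem_sphere_zero_iff_norm.1 ht]
  exact (h p).a_lt.le

end IntegralEquation

/-! ### Passing between matrices and their entries. -/

section Entries

open scoped Matrix.Norms.L2Operator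

/-- The `(i, j)` entry as a continuous linear functional. -/
noncomputable def entryCLM (i j : Fin 2) : Mat2 →L[ℂ] ℂ :=
  LinearMap.toContinuousLinearMap (Matrix.entryLinearMap ℂ ℂ i j)

theorem differentiableAt_of_entries {R : ℂ → Mat2} {z : ℂ}
    (h : ∀ i j, DifferentiableAt ℂ (fun w => R w i j) z) : DifferentiableAt ℂ R z := by
  have h1 : R = fun w => ∑ i, ∑ j, R w i j • Matrix.single i j (1 : ℂ) := by
    ext1 w
    conv_lhs => rw [Matrix.matrix_eq_sum_single (R w)]
    simp
  rw [h1]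
  exact DifferentiableAt.fun_sum fun i _ => DifferentiableAt.fun_sum fun j _ =>
    (h i j).smul_const _

theorem differentiableAt_entry {R : ℂ → Mat2} {z : ℂ} (h : DifferentiableAt ℂ R z) (i j : Fin 2) :
    DifferentiableAt ℂ (fun w => R w i j) z :=
  (entryCLM i j).differentiableAt.comp z h

theorem exists_entry_bound : ∃ c : ℝ, 0 ≤ c ∧ ∀ (A : Mat2) i j, ‖A i j‖ ≤ c * ‖A‖ := by
  refine ⟨∑ i, ∑ j, ‖entryCLM i j‖, by positivity, fun A i j => ?_⟩
  refine ((entryCLM i j).le_opNorm A).trans ?_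
  gcongr
  refine le_trans ?_ (Finset.single_le_sum (f := fun i => ∑ j, ‖entryCLM i j‖)
    (fun i _ => by positivity) (Finset.mem_univ i))
  exact Finset.single_le_sum (f := fun j => ‖entryCLM i j‖) (fun i _ => by positivity)
    (Finset.mem_univ j)

end Entries

/-! ### Analyticity and Schwarz symmetry of the jump matrix. -/

section JumpMatrix

open scoped Matrix.Norms.L2Operator ComplexConjugate Matrix

/-- The quotient 1 + ζ/z stays in the unit disc about 1, away from the logarithm's cut. -/
theorem add_div_self_mem_slitPlane {ζ : ℝ} (hζ : 0 < ζ) {z : ℂ} (hz : ζ < ‖z‖) :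
    (z + ζ) / z ∈ Complex.slitPlane ∧ z ≠ 0 := by
  have hz0 : z ≠ 0 := norm_pos_iff.1 (hζ.trans hz)
  refine ⟨?_, hz0⟩
  have h1 : (z + ζ) / z = 1 + ζ / z := by field_simp
  rw [h1]
  refine Complex.mem_slitPlane_of_norm_lt_one ?_
  rw [norm_div, Complex.norm_real, Real.norm_of_nonneg hζ.le, div_lt_one (hζ.trans hz)]
  exact hz

theorem differentiableAt_phase {ζ : ℝ} (hζ : 0 < ζ) (μ X T : ℝ) {z : ℂ} (hz : ζ < ‖z‖) :
    DifferentiableAt ℂ (phase ζ μ X T) z := by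
  obtain ⟨h1, h2⟩ := add_div_self_mem_slitPlane hζ hz
  unfold phase
  fun_prop (disch := assumption)

theorem continuousOn_phase {ζ : ℝ} (hζ : 0 < ζ) (μ : ℝ) :
    ContinuousOn (fun x : (ℝ × ℝ) × ℂ => phase ζ μ x.1.1 x.1.2 x.2) {x | ζ < ‖x.2‖} := by
  intro x hx
  obtain ⟨h1, h2⟩ := add_div_self_mem_slitPlane hζ hx
  refine ContinuousAt.continuousWithinAt ?_
  have h3 : ContinuousAt (fun x : (ℝ × ℝ) × ℂ => (x.2 + (ζ : ℂ)) / x.2) x := by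
    fun_prop (disch := assumption)
  have h4 := h3.clog h1
  unfold phase
  fun_prop

theorem phase_conj {ζ : ℝ} (hζ : 0 < ζ) (μ X T : ℝ) {z : ℂ} (hz : ζ < ‖z‖) :
    phase ζ μ X T (conj z) = conj (phase ζ μ X T z) := by
  obtain ⟨h1, h2⟩ := add_div_self_mem_slitPlane hζ hz
  have h3 : (conj z + (ζ : ℂ)) / conj z = conj ((z + ζ) / z) := by simp
  rw [phase, phase, h3, Complex.log_conj _ (Complex.slitPlane_arg_ne_pi h1)]
  simp

theorem expSigma3_eq_smul (a : ℂ) :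
    expSigma3 a = Complex.exp a • !![1, 0; 0, 0] + Complex.exp (-a) • !![0, 0; 0, 1] := by
  ext i j
  fin_cases i <;> fin_cases j <;> simp [expSigma3]

theorem differentiable_expSigma3 : Differentiable ℂ expSigma3 := by
  have : expSigma3 = fun a => Complex.exp a • (!![1, 0; 0, 0] : Mat2)
      + Complex.exp (-a) • (!![0, 0; 0, 1] : Mat2) := funext expSigma3_eq_smul
  rw [this]
  fun_prop

theorem expSigma3_neg_mul (a : ℂ) : expSigma3 (-a) * expSigma3 a = 1 := by
  ext i j
  fin_cases i <;> fin_cases j <;>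
    simp [expSigma3, Matrix.mul_apply, Fin.sum_univ_two, ← Complex.exp_add]

theorem expSigma3_mul_neg (a : ℂ) : expSigma3 a * expSigma3 (-a) = 1 :=
  mul_eq_one_comm.1 (expSigma3_neg_mul a)

theorem expSigma3_conjTranspose (a : ℂ) : (expSigma3 a)ᴴ = expSigma3 (conj a) := by
  ext i j
  fin_cases i <;> fin_cases j <;>
    simp [expSigma3, Matrix.conjTranspose_apply, ← Complex.exp_conj]

theorem rotMat_mul_conjTranspose : rotMat * rotMatᴴ = 1 := by
  have h : ((1 / √2 : ℝ) : ℂ) * ((1 / √2 : ℝ) : ℂ) = 1 / 2 := by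
    rw [← Complex.ofReal_mul, div_mul_div_comm, Real.mul_self_sqrt (by norm_num)]
    norm_num
  ext i j
  fin_cases i <;> fin_cases j <;>
    simp only [rotMat, Matrix.mul_apply, Fin.sum_univ_two, Matrix.conjTranspose_apply,
      Fin.zero_eta, Fin.mk_one, Matrix.of_apply, Matrix.cons_val_zero, Matrix.cons_val_one,
      Matrix.cons_val', Matrix.one_apply, RCLike.star_def, map_neg, Complex.conj_ofReal,
      neg_mul, mul_neg, neg_neg, h] <;> norm_num

/-- The inverse of the jump matrix. -/
noncomputable def jumpMatInv (ζ μ X T : ℝ) (Z : ℂ) : Mat2 :=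
  expSigma3 (-(Complex.I * phase ζ μ X T Z)) * rotMatᴴ * expSigma3 (Complex.I * phase ζ μ X T Z)

theorem jumpMat_mul_jumpMatInv (ζ μ X T : ℝ) (z : ℂ) :
    jumpMat ζ μ X T z * jumpMatInv ζ μ X T z = 1 := by
  rw [jumpMat, jumpMatInv]
  set A := expSigma3 (-(Complex.I * phase ζ μ X T z))
  set B := expSigma3 (Complex.I * phase ζ μ X T z)
  have h1 : B * A = 1 := expSigma3_mul_neg _
  have h2 : A * B = 1 := expSigma3_neg_mul _
  calc A * rotMat * B * (A * rotMatᴴ * B) = A * rotMat * (B * A) * rotMatᴴ * B := by noncomm_ring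
    _ = A * (rotMat * rotMatᴴ) * B := by rw [h1]; noncomm_ring
    _ = 1 := by rw [rotMat_mul_conjTranspose, mul_one, h2]

/-- By `phase_conj`, the conjugate of iθ(z̄) is −iθ(z). Taking adjoints reverses the product, so the
exponential factors return to their places and only `rotMat` is transposed. -/
theorem jumpMat_conj_conjTranspose {ζ : ℝ} (hζ : 0 < ζ) (μ X T : ℝ) {z : ℂ} (hz : ζ < ‖z‖) :
    (jumpMat ζ μ X T (conj z))ᴴ = jumpMatInv ζ μ X T z := by
  rw [jumpMat, jumpMatInv, phase_conj hζ μ X T hz, Matrix.conjTranspose_mul,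
    Matrix.conjTranspose_mul, expSigma3_conjTranspose, expSigma3_conjTranspose, mul_assoc]
  simp

theorem isJumpData_jumpMat {ζ a b : ℝ} (hζ : 0 < ζ) (hζa : ζ < a) (ha : a < 1) (hb : 1 < b)
    (μ X T : ℝ) : IsJumpData ζ a b (jumpMat ζ μ X T) (jumpMatInv ζ μ X T) where
  nonneg := hζ.le
  lt_a := hζa
  a_lt := ha
  lt_b := hb
  diff_W z hz := by
    have h1 := differentiableAt_phase hζ μ X T hz
    have h2 := fun w => differentiable_expSigma3.differentiableAt (x := w)
    refine (((h2 _).comp z (h1.const_mul Complex.I).neg).mul_const rotMat).mul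
      ((h2 _).comp z (h1.const_mul Complex.I)) |>.differentiableWithinAt
  diff_V z hz := by
    have h1 := differentiableAt_phase hζ μ X T hz
    have h2 := fun w => differentiable_expSigma3.differentiableAt (x := w)
    refine (((h2 _).comp z (h1.const_mul Complex.I).neg).mul_const rotMatᴴ).mul
      ((h2 _).comp z (h1.const_mul Complex.I)) |>.differentiableWithinAt
  mul_inv z _ := jumpMat_mul_jumpMatInv ζ μ X T z
  symm z hz := by
    rw [jumpMat_conj_conjTranspose hζ μ X T (by linarith)]
    exact jumpMat_mul_jumpMatInv ζ μ X T z

theorem continuousOn_expSigma3_conj_phase {ζ : ℝ} (hζ : 0 < ζ) (μ : ℝ) (Q : Mat2) :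
    ContinuousOn (fun x : (ℝ × ℝ) × ℂ =>
      expSigma3 (-(Complex.I * phase ζ μ x.1.1 x.1.2 x.2)) * Q *
        expSigma3 (Complex.I * phase ζ μ x.1.1 x.1.2 x.2)) {x | ζ < ‖x.2‖} := by
  have h1 := continuousOn_const.mul (continuousOn_phase hζ μ) (f := fun _ => Complex.I)
  have h2 := differentiable_expSigma3.continuous
  exact ((h2.comp_continuousOn h1.neg).mul continuousOn_const).mul (h2.comp_continuousOn h1)

end JumpMatrix

/-! ### Uniqueness, gluing and bounds for the model problem. -/

section Solutions

open scoped Matrix.Norms.L2Operator ComplexConjugate Matrix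

theorem closure_norm_gt_one : closure {z : ℂ | 1 < ‖z‖} = {z : ℂ | 1 ≤ ‖z‖} := by
  have h1 : {z : ℂ | 1 < ‖z‖} = (Metric.closedBall 0 1)ᶜ := by ext; simp
  rw [h1, closure_compl, interior_closedBall _ one_ne_zero]
  ext
  simp

theorem closure_norm_lt_one : closure {z : ℂ | ‖z‖ < 1} = {z : ℂ | ‖z‖ ≤ 1} := by
  have h1 : {z : ℂ | ‖z‖ < 1} = Metric.ball 0 1 := by ext; simp
  rw [h1, closure_ball _ one_ne_zero]
  ext
  simp

theorem continuousOn_extendFrom_of_tendsto {A B : Set ℂ} (hAB : B ⊆ closure A) {R L : ℂ → Mat2}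
    (hA : ∀ z ∈ A, ContinuousAt R z) (hL : ∀ z ∈ B \ A, Tendsto R (𝓝[A] z) (𝓝 (L z))) :
    ContinuousOn (extendFrom A R) B := by
  refine continuousOn_extendFrom hAB fun z hz => ?_
  by_cases h : z ∈ A
  · exact ⟨_, (hA z h).tendsto.mono_left nhdsWithin_le_nhds⟩
  · exact ⟨_, hL z ⟨hz, h⟩⟩

/-- A solution of the model problem, extended continuously to the circle from each side. -/
theorem IsModelRHPSolution.exists_extension {ζ μ X T : ℝ} {R : ℂ → Mat2}
    (h : IsModelRHPSolution ζ μ X T R) :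
    ∃ G D : ℂ → Mat2, ContinuousOn G (Metric.closedBall 0 1) ∧
      DifferentiableOn ℂ G (Metric.ball 0 1) ∧ ContinuousOn D {z : ℂ | 1 ≤ ‖z‖} ∧
      DifferentiableOn ℂ D {z : ℂ | 1 < ‖z‖} ∧ Tendsto D (Bornology.cobounded ℂ) (𝓝 1) ∧
      (∀ z : ℂ, ‖z‖ = 1 → G z = D z * jumpMat ζ μ X T z) ∧
      (∀ z : ℂ, ‖z‖ < 1 → R z = G z) ∧ (∀ z : ℂ, 1 < ‖z‖ → R z = D z) := by
  obtain ⟨Rp, Rm, -, -, hp, hm, hjump⟩ := h.boundary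
  have hdiff : ∀ z : ℂ, ‖z‖ ≠ 1 → DifferentiableAt ℂ R z := fun z hz =>
    differentiableAt_of_entries fun i j => (h.analytic i j z hz).differentiableAt
  have hin : ∀ z : ℂ, ‖z‖ < 1 → extendFrom {z : ℂ | ‖z‖ < 1} R z = R z := fun z hz =>
    extendFrom_eq (subset_closure hz)
      ((hdiff z hz.ne).continuousAt.tendsto.mono_left nhdsWithin_le_nhds)
  have hout : ∀ z : ℂ, 1 < ‖z‖ → extendFrom {z : ℂ | 1 < ‖z‖} R z = R z := fun z hz =>
    extendFrom_eq (subset_closure hz)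
      ((hdiff z hz.ne').continuousAt.tendsto.mono_left nhdsWithin_le_nhds)
  refine ⟨extendFrom {z : ℂ | ‖z‖ < 1} R, extendFrom {z : ℂ | 1 < ‖z‖} R, ?_, ?_, ?_, ?_, ?_, ?_,
    fun z hz => (hin z hz).symm, fun z hz => (hout z hz).symm⟩
  · refine continuousOn_extendFrom_of_tendsto (L := Rp) ?_
      (fun z hz => (hdiff z (ne_of_lt hz)).continuousAt) fun z hz => hp z ?_
    · rw [closure_norm_lt_one]
      exact fun z hz => by simpa using hz
    · exact le_antisymm (by simpa using hz.1) (not_lt.1 hz.2)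
  · refine DifferentiableOn.congr (f := R) (fun z hz => (hdiff z (ne_of_lt
      (by simpa using hz))).differentiableWithinAt) fun z hz => hin z (by simpa using hz)
  · refine continuousOn_extendFrom_of_tendsto (L := Rm) closure_norm_gt_one.ge
      (fun z hz => (hdiff z (ne_of_gt hz)).continuousAt) fun z hz => hm z ?_
    exact le_antisymm (not_lt.1 hz.2) hz.1
  · exact DifferentiableOn.congr (f := R)
      (fun z hz => (hdiff z (ne_of_gt hz)).differentiableWithinAt) fun z hz => hout z hz
  · have h1 : Tendsto R (Bornology.cobounded ℂ) (𝓝 1) := by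
      refine tendsto_pi_nhds.2 fun i => tendsto_pi_nhds.2 fun j => ?_
      have h2 := (h.normalization i j).trans_tendsto tendsto_inv₀_cobounded
      exact tendsto_sub_nhds_zero_iff.1 h2
    refine h1.congr' ?_
    filter_upwards [eventually_cobounded_le_norm (2 : ℝ)] with z hz
    exact (hout z (by linarith)).symm
  · intro z hz
    rw [extendFrom_eq (closure_norm_lt_one.ge hz.le) (hp z hz),
      extendFrom_eq (closure_norm_gt_one.ge hz.ge) (hm z hz), hjump z hz]

/-- In the difference the normalizations cancel, so the vanishing lemma applies to the one-sided
extensions. -/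
theorem IsModelRHPSolution.unique {ζ μ X T : ℝ} (hζ0 : 0 < ζ) (hζ1 : ζ < 1) {R₁ R₂ : ℂ → Mat2}
    (h₁ : IsModelRHPSolution ζ μ X T R₁) (h₂ : IsModelRHPSolution ζ μ X T R₂) (z : ℂ)
    (hz : ‖z‖ ≠ 1) : R₁ z = R₂ z := by
  obtain ⟨G₁, D₁, hG₁, hG₁', hD₁, hD₁', hl₁, hj₁, hi₁, ho₁⟩ := h₁.exists_extension
  obtain ⟨G₂, D₂, hG₂, hG₂', hD₂, hD₂', hl₂, hj₂, hi₂, ho₂⟩ := h₂.exists_extension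
  have hvan := vanishing_of_schwarz_symmetric (V := jumpMat ζ μ X T) (hG₁.sub hG₂) (hG₁'.sub hG₂')
    (hD₁.sub hD₂) (hD₁'.sub hD₂') (by have := hl₁.sub hl₂; rw [sub_self] at this; exact this)
    (fun z hz => by
      rw [jumpMat_conj_conjTranspose hζ0 μ X T (by linarith)]
      exact jumpMat_mul_jumpMatInv ζ μ X T z)
    (fun z hz => by
      simp only [Pi.sub_apply]
      rw [hj₁ z hz, hj₂ z hz, sub_mul])
  rcases lt_or_gt_of_ne hz with h | h
  · rw [hi₁ z h, hi₂ z h]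
    exact sub_eq_zero.1 (hvan.1 z h.le)
  · rw [ho₁ z h, ho₂ z h]
    exact sub_eq_zero.1 (hvan.2 z h.le)

/-- Functions analytic across the circle from either side and related by the jump matrix glue to a
solution of the model problem. -/
theorem isModelRHPSolution_of_glue {ζ μ X T a b : ℝ} (ha : a < 1) (hb : 1 < b) {E₀ F₀ : ℂ → Mat2}
    (hE : DifferentiableOn ℂ E₀ (Metric.ball 0 b)) (hF : DifferentiableOn ℂ F₀ {z : ℂ | a < ‖z‖})
    (hjump : ∀ z : ℂ, ‖z‖ = 1 → E₀ z = F₀ z * jumpMat ζ μ X T z)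
    (hnorm : (fun z => F₀ z - 1) =O[Bornology.cobounded ℂ] (fun z : ℂ => z⁻¹)) :
    IsModelRHPSolution ζ μ X T (fun z => if ‖z‖ < 1 then E₀ z else F₀ z) := by
  have hE' : ∀ z : ℂ, ‖z‖ < b → DifferentiableAt ℂ E₀ z := fun z hz =>
    hE.differentiableAt (Metric.isOpen_ball.mem_nhds (by simpa using hz))
  have hF' : ∀ z : ℂ, a < ‖z‖ → DifferentiableAt ℂ F₀ z := fun z hz =>
    hF.differentiableAt ((isOpen_lt continuous_const continuous_norm).mem_nhds hz)
  refine ⟨fun i j => ?_, ⟨E₀, F₀, ?_, ?_, ?_, ?_, hjump⟩, fun i j => ?_⟩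
  · have hopen : IsOpen {z : ℂ | ‖z‖ ≠ 1} := isOpen_ne_fun continuous_norm continuous_const
    refine DifferentiableOn.analyticOnNhd (fun z hz => ?_) hopen
    refine (differentiableAt_entry ?_ i j).differentiableWithinAt
    rcases lt_or_gt_of_ne hz with h | h
    · refine (hE' z (h.trans hb)).congr_of_eventuallyEq ?_
      filter_upwards [(isOpen_lt continuous_norm continuous_const).mem_nhds h] with w hw
      exact if_pos hw
    · refine (hF' z (ha.trans h)).congr_of_eventuallyEq ?_
      filter_upwards [(isOpen_lt continuous_const continuous_norm).mem_nhds h] with w hw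
      exact if_neg (not_lt.2 (le_of_lt hw))
  · exact fun z hz => (hE' z (by rw [hz]; exact hb)).continuousAt.continuousWithinAt
  · exact fun z hz => (hF' z (by rw [hz]; exact ha)).continuousAt.continuousWithinAt
  · intro s hs
    refine ((hE' s (by rw [hs]; exact hb)).continuousAt.tendsto.mono_left
      nhdsWithin_le_nhds).congr' ?_
    filter_upwards [self_mem_nhdsWithin] with w hw
    exact (if_pos hw).symm
  · intro s hs
    refine ((hF' s (by rw [hs]; exact ha)).continuousAt.tendsto.mono_left
      nhdsWithin_le_nhds).congr' ?_
    filter_upwards [self_mem_nhdsWithin] with w hw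
    exact (if_neg (not_lt.2 (le_of_lt hw))).symm
  · refine (((entryCLM i j).isBigO_comp _ _).trans hnorm).congr' ?_ EventuallyEq.rfl
    filter_upwards [eventually_cobounded_le_norm (2 : ℝ)] with w hw
    rw [if_neg (by linarith)]
    rfl

theorem exists_bounded_modelRHPSolution {ζ : ℝ} (hζ0 : 0 < ζ) (hζ1 : ζ < 1) (μ : ℝ) :
    ∃ R : ℝ × ℝ → ℂ → Mat2, (∀ p, IsModelRHPSolution ζ μ p.1 p.2 (R p)) ∧
      ∀ S : Set (ℝ × ℝ), IsCompact S → ∃ C : ℝ, ∀ p ∈ S, ∀ z i j, ‖R p z i j‖ ≤ C := by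
  -- The radii do not depend on (X, T), so one pair of contours serves the whole family; b = 2 is an
  -- arbitrary radius above 1.
  obtain ⟨a, hζa, ha⟩ := exists_between hζ1
  obtain ⟨E₀, F₀, hE, hF, hj, hO, hbd⟩ := exists_bounded_family (b := 2)
    (fun p : ℝ × ℝ => isJumpData_jumpMat hζ0 hζa ha one_lt_two μ p.1 p.2) (hζ0.trans hζa).le hζa
    (ha.trans one_lt_two) (continuousOn_expSigma3_conj_phase hζ0 μ rotMat)
    (continuousOn_expSigma3_conj_phase hζ0 μ rotMatᴴ)
  refine ⟨fun p z => if ‖z‖ < 1 then E₀ p z else F₀ p z, fun p =>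
    isModelRHPSolution_of_glue ha one_lt_two (hE p) (hF p) (hj p) (hO p), fun S hS => ?_⟩
  obtain ⟨C, hC⟩ := hbd S hS
  obtain ⟨c, hc, hentry⟩ := exists_entry_bound
  refine ⟨c * C, fun p hp z i j => (hentry _ i j).trans ?_⟩
  refine mul_le_mul_of_nonneg_left ?_ hc
  split_ifs with h
  · exact (hC p hp).1 z h.le
  · exact (hC p hp).2 z (not_lt.1 h)

end Solutions

theorem theorem5p3 (ζ μ : ℝ) (hζ0 : 0 < ζ) (hζ1 : ζ < 1) (hμ : 0 < μ) :
    (∀ X T : ℝ,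
      (∃ R : ℂ → Mat2, IsModelRHPSolution ζ μ X T R) ∧
      (∀ R₁ R₂ : ℂ → Mat2, IsModelRHPSolution ζ μ X T R₁ → IsModelRHPSolution ζ μ X T R₂ →
        ∀ Z : ℂ, ‖Z‖ ≠ 1 → R₁ Z = R₂ Z)) ∧
    (∀ K : Set (ℝ × ℝ), IsCompact K →
      ∃ C : ℝ, ∀ X T : ℝ, (X, T) ∈ K →
        ∀ R : ℂ → Mat2, IsModelRHPSolution ζ μ X T R →
          ∀ Z : ℂ, ‖Z‖ ≠ 1 → ∀ i j, ‖R Z i j‖ ≤ C) := by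
  obtain ⟨R₀, hR₀, hbd⟩ := exists_bounded_modelRHPSolution hζ0 hζ1 μ
  refine ⟨fun X T => ⟨⟨R₀ (X, T), hR₀ (X, T)⟩, fun R₁ R₂ h₁ h₂ Z hZ =>
    h₁.unique hζ0 hζ1 h₂ Z hZ⟩, fun K hK => ?_⟩
  obtain ⟨C, hC⟩ := hbd K hK
  refine ⟨C, fun X T hXT R hR Z hZ i j => ?_⟩
  -- Uniqueness transfers the bound from the constructed family to an arbitrary solution.
  rw [hR.unique hζ0 hζ1 (hR₀ (X, T)) Z hZ]
  exact hC (X, T) hXT Z i j
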